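/- Let $d\ge 1$. A copula on $\mathbb R^d$ is the distribution function of a probability measure on $\mathbb R^d$ all of whose one-dimensional margins are uniform on $[0,1]$. A $D$-norm on $\mathbb R^d$ is a norm of the form $\|\mathbf x\|_D=E\big(\max_{1\le i\le d}|x_i|Z_i\big)$, $\mathbf x\in\mathbb R^d$, for some random vector $\mathbf Z=(Z_1,\dots,Z_d)$ with $Z_i\ge 0$ and $E(Z_i)=1$, $1\le i\le d$. Let $\mathbf X^{(1)},\mathbf X^{(2)},\dots$ be independent random vectors in $\mathbb R^d$ whose common distribution function is a copula $C$, and suppose that, for some $D$-norm $\|\cdot\|_D$ on $\mathbb R^d$, $$C(\mathbf u)=1-\|\mathbf 1-\mathbf u\|_D+o(\|\mathbf 1-\mathbf u\|)\qquad\text{as }\mathbf u\to\mathbf 1=(1,\dots,1),\text{ uniformly for }\mathbf u\in[0,1]^d.$$ For $1\le i\le d$ let $X_{1:n,i}\le X_{2:n,i}\le\dots\le X_{n:n,i}$ denote the ordered values of the $i$-th components of $\mathbf X^{(1)},\dots,\mathbf X^{(n)}$. Let $k=k(n)\in\{1,\dots,n-1\}$, $n\ge 2$, satisfy $k\to\infty$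 and $k/n\to 0$ as $n\to\infty$. Then the $d\times d$ matrix $\Sigma=(\sigma_{ij})$ with $$\sigma_{ij}=\begin{cases}1,& i=j,\\ 2-\|\mathbf e_i+\mathbf e_j\|_D,& i\ne j,\end{cases}$$ where $\mathbf e_i$ is the $i$-th unit vector of $\mathbb R^d$, is positive semidefinite, and $$\left(\frac{n}{\sqrt k}\Big(X_{n-k:n,i}-\frac{n-k}{n}\Big)\right)_{i=1}^d\;\longrightarrow\; N(\mathbf 0,\Sigma)\quad\text{in distribution as } n\to\infty .$$ -/

import Mathlib

open MeasureTheory ProbabilityTheory Filter Topology Asymptotics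

/-- `C : ℝᵈ → ℝ` is a copula: it is the distribution function of a probability measure on `ℝᵈ`
all of whose one-dimensional margins are uniform on `[0, 1]`. -/
def IsCopula {d : ℕ} (C : (Fin d → ℝ) → ℝ) : Prop :=
  ∃ μ : Measure (Fin d → ℝ), IsProbabilityMeasure μ ∧
    (∀ i, μ.map (fun x => x i) = volume.restrict (Set.Icc (0 : ℝ) 1)) ∧
    ∀ u, C u = μ.real (Set.Iic u)

/-- `N` is a `D`-norm on `ℝᵈ`: there is a generator `Z = (Z₁, …, Z_d)` with `Zᵢ ≥ 0` and
`E Zᵢ = 1` such that `N x = E (maxᵢ |xᵢ| Zᵢ)`. The generator enters only through its law `ν`. -/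
def IsDNorm {d : ℕ} (N : (Fin d → ℝ) → ℝ) : Prop :=
  ∃ ν : Measure (Fin d → ℝ), IsProbabilityMeasure ν ∧
    (∀ i, ∀ᵐ z ∂ν, 0 ≤ z i) ∧
    (∀ i, Integrable (fun z => z i) ν ∧ ∫ z, z i ∂ν = 1) ∧
    ∀ x, N x = ∫ z, (⨆ i, |x i| * z i) ∂ν

/-- The expansion `C(u) = 1 - ‖1 - u‖_D + o(‖1 - u‖)` as `u → 1`, uniformly for `u ∈ [0, 1]ᵈ`. -/
def HasDNormExpansion {d : ℕ} (C N : (Fin d → ℝ) → ℝ) : Prop :=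
  (fun u => C u - (1 - N (1 - u))) =o[𝓝[Set.Icc 0 1] 1] (fun u => ‖1 - u‖)

/-- The order statistic `x_{j:n}`, the `j`-th smallest among `x₁, …, xₙ` counted with
multiplicity, for `1 ≤ j ≤ n` (and `0` for other `j`). -/
noncomputable def orderStat {n : ℕ} (x : Fin n → ℝ) (j : ℕ) : ℝ :=
  if h : 1 ≤ j ∧ j ≤ n then x (Tuple.sort x ⟨j - 1, by omega⟩) else 0

/-- The normalized vector `(n / √k) (X_{n-k:n,i} - (n-k)/n)`, `1 ≤ i ≤ d`, of componentwise
intermediate order statistics of the sample `X 0, …, X (n-1)`. -/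
noncomputable def normalizedIntermediateOS {d : ℕ} {Ω : Type*} (X : ℕ → Ω → Fin d → ℝ)
    (n k : ℕ) (ω : Ω) : EuclideanSpace ℝ (Fin d) :=
  WithLp.toLp 2 fun i =>
    (n : ℝ) / √(k : ℝ) *
      (orderStat (fun j : Fin n => X j ω i) (n - k) - ((n : ℝ) - (k : ℝ)) / (n : ℝ))

/-- The matrix with `σᵢᵢ = 1` and `σᵢⱼ = 2 - ‖eᵢ + eⱼ‖_D` for `i ≠ j`. -/
noncomputable def asymptoticCov {d : ℕ} (N : (Fin d → ℝ) → ℝ) : Matrix (Fin d) (Fin d) ℝ :=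
  Matrix.of fun i j => if i = j then 1 else 2 - N (Pi.single i 1 + Pi.single j 1)

/-! The proof turns order statistics into exceedance counts. The order statistic `X_{n-k:n,i}` is at
most `c` exactly when at most `k` sample points have `i`-th component above `c`. At the level `c = 1
- (k - y√k)/n` the expected count is `k - y√k`, so for large `n` the event that the normalized order
statistic is `≤ y` is the event that the centred count over `c`, divided by `√k`, is `≤ y`
(`normalizedIntermediateOS_le_iff`).

This level depends on `y`, but replacing it by `1 - k/n` changes the scaled count by a variable of
second moment at most `|y|/√k`, which tends to 0. A grid argument (`tendstoInMeasure_sub_of_le_iff`)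
then shows that each normalized order statistic differs from the scaled count over `1 - k/n` by a
term vanishing in probability. It remains to treat the vector of these counts, which are sums of
independent bounded vectors.

For them, a second order expansion of characteristic functions gives a central limit theorem
(`tendsto_integral_exp_scaledSum`). The limiting covariances are the limits of `s⁻¹ P(X_i > 1 - s,
X_j > 1 - s)` as `s = k/n → 0`: inclusion-exclusion expresses this probability through `C(1 - s(e_i
+ e_j))`, and the expansion of `C` yields `2 - ‖e_i + e_j‖_D`. The products of the means are `s²`
and disappear. As a limit of rescaled covariance matrices, `Σ` is positive semidefinite. -/

/-! ### Distribution functions, order statistics and comparison in probability -/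

/-- Probability measures on `ℝᵈ` with the same distribution function are equal. -/
theorem measure_ext_of_pi_Iic {ι : Type*} [Finite ι] {μ ν : Measure (ι → ℝ)}
    [IsProbabilityMeasure μ] [IsProbabilityMeasure ν]
    (h : ∀ u, μ (Set.Iic u) = ν (Set.Iic u)) : μ = ν := by
  have hspan : IsCountablySpanning (Set.range (Set.Iic : ℝ → Set ℝ)) :=
    ⟨fun n : ℕ => Set.Iic (n : ℝ), fun n => ⟨n, rfl⟩, by
      ext x; simpa using exists_nat_ge x⟩
  refine ext_of_generate_finite
    (Set.pi Set.univ '' Set.pi Set.univ fun _ : ι => Set.range (Set.Iic : ℝ → Set ℝ))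
    (generateFrom_eq_pi (fun _ => ?_) (fun _ => hspan)).symm
    (IsPiSystem.pi fun _ => isPiSystem_Iic) ?_ (by simp)
  · rw [← borel_eq_generateFrom_Iic]
    exact (BorelSpace.measurable_eq (α := ℝ)).symm
  · rintro _ ⟨s, hs, rfl⟩
    choose u hu using fun i => hs i (Set.mem_univ i)
    obtain rfl : (fun i => Set.Iic (u i)) = s := funext hu
    rw [Set.pi_univ_Iic]
    exact h u

/-- An order statistic is at most `c` iff few enough sample points exceed `c`. -/
theorem orderStat_le_iff {n : ℕ} (x : Fin n → ℝ) {m : ℕ} (hm : 1 ≤ m) (hmn : m ≤ n) (c : ℝ) :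
    orderStat x m ≤ c ↔ (Finset.univ.filter fun j => c < x j).card ≤ n - m := by
  have hcard : (Finset.univ.filter fun j => c < x j).card =
      (Finset.univ.filter fun j => c < x (Tuple.sort x j)).card := by
    refine (Finset.card_bij (fun j _ => Tuple.sort x j) (by simp) (by simp) fun j hj => ?_).symm
    exact ⟨(Tuple.sort x).symm j, by simpa using hj, by simp⟩
  have hmono : Monotone (x ∘ Tuple.sort x) := Tuple.monotone_sort x
  rw [hcard, orderStat, dif_pos ⟨hm, hmn⟩]
  constructor
  · intro h
    have : (Finset.univ.filter fun j => c < x (Tuple.sort x j)) ⊆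
        Finset.Ioi (⟨m - 1, by omega⟩ : Fin n) := by
      intro j hj
      rw [Finset.mem_Ioi]
      by_contra hle
      have := hmono (not_lt.mp hle)
      simp only [Finset.mem_filter, Finset.mem_univ, true_and, Function.comp_apply] at hj this
      linarith
    refine (Finset.card_le_card this).trans ?_
    rw [Fin.card_Ioi]
    simp only
    omega
  · intro h
    by_contra hc
    have : Finset.Ici (⟨m - 1, by omega⟩ : Fin n) ⊆
        (Finset.univ.filter fun j => c < x (Tuple.sort x j)) := by
      intro j hj
      have := hmono (Finset.mem_Ici.mp hj)
      simp only [Finset.mem_filter, Finset.mem_univ, true_and, Function.comp_apply] at this ⊢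
      linarith
    have := (Finset.card_le_card this).trans h
    rw [Fin.card_Ici] at this
    simp only at this
    omega

theorem measurable_orderStat {n : ℕ} (m : ℕ) : Measurable fun x : Fin n → ℝ => orderStat x m := by
  by_cases h : 1 ≤ m ∧ m ≤ n
  · refine measurable_of_Iic fun c => ?_
    have : (fun x : Fin n → ℝ => orderStat x m) ⁻¹' Set.Iic c =
        {x | ∑ j, Set.indicator (Set.Ioi c) (1 : ℝ → ℝ) (x j) ≤ ((n - m : ℕ) : ℝ)} := by
      ext x
      simp only [Set.mem_preimage, Set.mem_Iic, Set.mem_ofPred_eq, orderStat_le_iff x h.1 h.2 c,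
        Set.indicator_apply, Set.mem_Ioi, Pi.one_apply, Finset.sum_boole]
      exact Nat.cast_le.symm
    rw [this]
    refine measurableSet_le (Finset.measurable_sum _ fun j _ => ?_) measurable_const
    exact (measurable_one.indicator measurableSet_Ioi).comp (measurable_pi_apply j)
  · simp [orderStat, h]

/-- If `{V n ≤ y} = {U y n ≤ y}` for large `n`, where `U y n - W n → 0` in probability for every
`y` and `W` is tight, then `V n - W n → 0` in probability. -/
theorem tendstoInMeasure_sub_of_le_iff {Ω : Type*} [MeasurableSpace Ω] {P : Measure Ω}
    {V W : ℕ → Ω → ℝ} {U : ℝ → ℕ → Ω → ℝ}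
    (hVU : ∀ y, ∀ᶠ n in atTop, ∀ ω, V n ω ≤ y ↔ U y n ω ≤ y)
    (hUW : ∀ y, ∀ δ : ℝ, 0 < δ → Tendsto (fun n => P {ω | δ ≤ |U y n ω - W n ω|}) atTop (𝓝 0))
    (hW : ∀ η : ENNReal, 0 < η → ∃ M : ℝ, ∀ᶠ n in atTop, P {ω | M ≤ |W n ω|} ≤ η)
    {ε : ℝ} (hε : 0 < ε) : Tendsto (fun n => P {ω | ε ≤ |V n ω - W n ω|}) atTop (𝓝 0) := by
  rw [ENNReal.tendsto_nhds_zero]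
  intro η hη
  obtain ⟨M, hM⟩ := hW (η / 2) (ENNReal.half_pos hη.ne')
  set δ := ε / 2 with hδ
  have hδ0 : 0 < δ := half_pos hε
  -- When `|W| < M`, a deviation `|V - W| ≥ 2δ` leaves a point `lδ` of the grid between `V` and `W`,
  -- at distance at least `δ` from `W`. There `U (l * δ)` lies on the same side of `lδ` as `V`,
  -- hence differs from `W` by at least `δ`. The margin 2 in `L` keeps all such `l` in a finite
  -- range independent of `n`, so a union bound applies.
  set L : ℤ := ⌈M / δ⌉ + 2 with hL
  have hsum : Tendsto (fun n => ∑ l ∈ Finset.Icc (-L) L, P {ω | δ ≤ |U (l * δ) n ω - W n ω|})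
      atTop (𝓝 0) := by
    simpa using tendsto_finsetSum (Finset.Icc (-L) L) fun l _ => hUW (l * δ) δ hδ0
  have hall : ∀ᶠ n in atTop, ∀ l ∈ Finset.Icc (-L) L, ∀ ω, V n ω ≤ l * δ ↔ U (l * δ) n ω ≤ l * δ :=
    (Filter.eventually_all_finset _).2 fun l _ => hVU (l * δ)
  filter_upwards [hM, hall, ENNReal.tendsto_nhds_zero.1 hsum (η / 2) (ENNReal.half_pos hη.ne')]
    with n h1 h2 h3
  have hsub : {ω | ε ≤ |V n ω - W n ω|} ⊆ {ω | M ≤ |W n ω|} ∪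
      ⋃ l ∈ Finset.Icc (-L) L, {ω | δ ≤ |U (l * δ) n ω - W n ω|} := by
    intro ω hω
    simp only [Set.mem_ofPred_eq, Set.mem_union, Set.mem_iUnion] at hω ⊢
    by_cases hMW : M ≤ |W n ω|
    · exact Or.inl hMW
    right
    obtain ⟨hw1, hw2⟩ := abs_lt.1 (not_le.1 hMW)
    have hw1' : -(M / δ) < W n ω / δ := by rw [← neg_div]; gcongr
    have hw2' : W n ω / δ < M / δ := by gcongr
    have hc := Int.le_ceil (M / δ)
    have hWd : W n ω = W n ω / δ * δ := by field_simp
    rcases le_abs.1 hω with h | h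
    · set l : ℤ := ⌈W n ω / δ⌉ + 1 with hl
      have hl1 := Int.le_ceil (W n ω / δ)
      have hl2 := Int.ceil_lt_add_one (W n ω / δ)
      have hlL : l ∈ Finset.Icc (-L) L := by
        rw [Finset.mem_Icc]
        constructor
        · have : ((-L : ℤ) : ℝ) ≤ l := by rw [hL, hl]; push_cast; linarith
          exact_mod_cast this
        · have := Int.ceil_le_ceil hw2'.le
          omega
      have e1 : W n ω + δ ≤ l * δ := by
        have : (W n ω / δ + 1) * δ ≤ l * δ := by gcongr; rw [hl]; push_cast; linarith
        linarith
      have e2 : l * δ < V n ω := by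
        have : (l : ℝ) * δ < (W n ω / δ + 2) * δ := by gcongr; rw [hl]; push_cast; linarith
        linarith
      refine ⟨l, hlL, ?_⟩
      have := mt (h2 l hlL ω).2 (not_le.2 e2)
      exact le_abs.2 (Or.inl (by linarith))
    · set l : ℤ := ⌊W n ω / δ⌋ - 1 with hl
      have hl1 := Int.floor_le (W n ω / δ)
      have hl2 := Int.lt_floor_add_one (W n ω / δ)
      have hlL : l ∈ Finset.Icc (-L) L := by
        rw [Finset.mem_Icc]
        have hcL : (L : ℝ) = (⌈M / δ⌉ : ℝ) + 2 := by rw [hL]; push_cast; ring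
        have hll : (l : ℝ) = (⌊W n ω / δ⌋ : ℝ) - 1 := by rw [hl]; push_cast; ring
        constructor
        · have : ((-L : ℤ) : ℝ) ≤ l := by push_cast; linarith
          exact_mod_cast this
        · have : (l : ℝ) ≤ L := by linarith
          exact_mod_cast this
      have e1 : l * δ ≤ W n ω - δ := by
        have : (l : ℝ) * δ ≤ (W n ω / δ - 1) * δ := by gcongr; rw [hl]; push_cast; linarith
        linarith
      have e2 : V n ω ≤ l * δ := by
        have : (W n ω / δ - 2) * δ ≤ (l : ℝ) * δ := by gcongr; rw [hl]; push_cast; linarith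
        linarith
      refine ⟨l, hlL, ?_⟩
      have := (h2 l hlL ω).1 e2
      exact le_abs.2 (Or.inr (by linarith))
  calc P {ω | ε ≤ |V n ω - W n ω|}
      ≤ P {ω | M ≤ |W n ω|} + P (⋃ l ∈ Finset.Icc (-L) L, {ω | δ ≤ |U (l * δ) n ω - W n ω|}) :=
        (measure_mono hsub).trans (measure_union_le _ _)
    _ ≤ η / 2 + η / 2 := add_le_add h1 ((measure_biUnion_finset_le _ _).trans h3)
    _ = η := ENNReal.add_halves η

/-! ### Chebyshev's inequality and a central limit theorem for scaled sums -/

/-- The sum of the centred values `g (X j)`, `j < n`, divided by `√k`. -/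
noncomputable def scaledSum {Ω α : Type*} [MeasurableSpace α] (μ : Measure α) (X : ℕ → Ω → α)
    (g : α → ℝ) (n k : ℕ) (ω : Ω) : ℝ :=
  (√(k : ℝ))⁻¹ * ∑ j ∈ Finset.range n, (g (X j ω) - ∫ x, g x ∂μ)

section scaledSum

variable {Ω α : Type*} [MeasurableSpace α] {μ : Measure α} {X : ℕ → Ω → α}

theorem integrable_of_abs_le [IsProbabilityMeasure μ] {g : α → ℝ} (hg : Measurable g) {B : ℝ}
    (hB : ∀ x, |g x| ≤ B) : Integrable g μ :=
  .of_bound hg.aestronglyMeasurable B (ae_of_all _ hB)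

theorem scaledSum_sub [IsProbabilityMeasure μ] {g h : α → ℝ} (hg : Integrable g μ)
    (hh : Integrable h μ) (n k : ℕ) (ω : Ω) :
    scaledSum μ X g n k ω - scaledSum μ X h n k ω = scaledSum μ X (fun x => g x - h x) n k ω := by
  simp only [scaledSum, ← mul_sub, ← Finset.sum_sub_distrib, integral_sub hg hh]
  congr 1
  exact Finset.sum_congr rfl fun j _ => by ring

theorem sum_mul_scaledSum {ι : Type*} (s : Finset ι) {g : ι → α → ℝ}
    (hg : ∀ i, Integrable (g i) μ) (t : ι → ℝ) (n k : ℕ) (ω : Ω) :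
    ∑ i ∈ s, t i * scaledSum μ X (g i) n k ω =
      scaledSum μ X (fun x => ∑ i ∈ s, t i * g i x) n k ω := by
  have : ∫ x, ∑ i ∈ s, t i * g i x ∂μ = ∑ i ∈ s, t i * ∫ x, g i x ∂μ := by
    rw [integral_finsetSum _ fun i _ => (hg i).const_mul (t i)]
    simp_rw [integral_const_mul]
  simp only [scaledSum, this, ← Finset.sum_sub_distrib, ← mul_sub]
  simp_rw [mul_left_comm (t _), ← Finset.mul_sum]
  rw [Finset.sum_comm]
  simp_rw [← Finset.mul_sum]

variable [MeasurableSpace Ω] {P : Measure Ω}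

theorem measurable_scaledSum (hX : ∀ j, Measurable (X j)) {g : α → ℝ} (hg : Measurable g)
    (n k : ℕ) : Measurable (scaledSum μ X g n k) := by
  unfold scaledSum
  fun_prop

/-- Chebyshev's inequality for scaled sums. -/
theorem measure_le_abs_scaledSum_le [IsProbabilityMeasure P] [IsProbabilityMeasure μ]
    (hX : ∀ j, Measurable (X j)) (hind : iIndepFun X P)
    (hlaw : ∀ j, P.map (X j) = μ) {g : α → ℝ} (hg : Measurable g) {B : ℝ} (hB : ∀ x, |g x| ≤ B)
    (n k : ℕ) {ε : ℝ} (hε : 0 < ε) :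
    P {ω | ε ≤ |scaledSum μ X g n k ω|} ≤
      ENNReal.ofReal ((n : ℝ) / k * (∫ x, g x ^ 2 ∂μ) / ε ^ 2) := by
  set m := ∫ x, g x ∂μ with hm
  have hgX : ∀ j, MemLp (fun ω => g (X j ω) - m) 2 P := fun j =>
    .of_bound ((hg.comp (hX j)).sub_const m).aestronglyMeasurable (B + |m|) (ae_of_all _ fun ω => by
      simpa using (abs_sub _ _).trans (add_le_add_left (hB _) _))
  have hmean : ∀ j, ∫ ω, (g (X j ω) - m) ∂P = 0 := fun j => by
    have : ∫ ω, g (X j ω) ∂P = m := by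
      rw [hm, ← hlaw j, integral_map (hX j).aemeasurable hg.aestronglyMeasurable]
    have hint : Integrable (fun ω => g (X j ω)) P :=
      integrable_of_abs_le (hg.comp (hX j)) fun ω => hB _
    rw [integral_sub hint (integrable_const _), this]
    simp
  have hvar : ∀ j, variance (fun ω => g (X j ω) - m) P ≤ ∫ x, g x ^ 2 ∂μ := fun j => by
    have h1 : variance (fun ω => g (X j ω) - m) P = variance (fun ω => g (X j ω)) P :=
      variance_sub_const (hg.comp (hX j)).aestronglyMeasurable m
    rw [h1]
    refine (variance_le_expectation_sq (hg.comp (hX j)).aestronglyMeasurable).trans (le_of_eq ?_)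
    rw [← hlaw j, integral_map (hX j).aemeasurable (by fun_prop)]
    rfl
  have hsum : MemLp (scaledSum μ X g n k) 2 P :=
    (memLp_finsetSum (Finset.range n) fun j _ => hgX j).const_mul _
  have hEsum : ∫ ω, scaledSum μ X g n k ω ∂P = 0 := by
    unfold scaledSum
    rw [integral_const_mul, integral_finsetSum _ fun j _ => (hgX j).integrable (by norm_num)]
    simp [hmean]
  have hVsum : variance (scaledSum μ X g n k) P ≤ (n : ℝ) / k * ∫ x, g x ^ 2 ∂μ := by
    have h1 : variance (scaledSum μ X g n k) P = ((√(k : ℝ))⁻¹) ^ 2 *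
        variance (∑ j ∈ Finset.range n, fun ω => g (X j ω) - m) P := by
      rw [← variance_const_mul]
      congr 1
      ext ω
      simp [scaledSum, hm]
    rw [h1, IndepFun.variance_sum (fun j _ => hgX j) fun i _ j _ hij =>
      (hind.indepFun hij).comp (φ := fun x => g x - m) (ψ := fun x => g x - m) (by fun_prop)
        (by fun_prop), inv_pow, Real.sq_sqrt (Nat.cast_nonneg _), div_eq_inv_mul, mul_assoc]
    gcongr
    simpa using Finset.sum_le_sum fun j (_ : j ∈ Finset.range n) => hvar j
  have := meas_ge_le_variance_div_sq hsum hε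
  rw [hEsum] at this
  simp only [sub_zero] at this
  exact this.trans (ENNReal.ofReal_le_ofReal (by gcongr))

/-- Second order expansion of the characteristic function of a bounded centred variable. -/
theorem norm_integral_exp_sub_le [IsProbabilityMeasure μ] {h : α → ℝ} (hh : Measurable h) {B : ℝ}
    (hB : ∀ x, |h x| ≤ B) (h0 : ∫ x, h x ∂μ = 0) {s : ℝ} (hs : |s| * B ≤ 1) :
    ‖∫ x, Complex.exp ((s * h x : ℝ) * Complex.I) ∂μ - (1 - s ^ 2 / 2 * ∫ x, h x ^ 2 ∂μ : ℝ)‖ ≤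
      |s| ^ 3 * B * ∫ x, h x ^ 2 ∂μ := by
  have hint := integrable_of_abs_le (μ := μ) hh hB
  have hint2 : Integrable (fun x => h x ^ 2) μ :=
    integrable_of_abs_le (B := B ^ 2) (by fun_prop) fun x => by
      rw [abs_pow]; gcongr; exact hB x
  -- Taylor expansion to second order; bounding only one factor `|h x|` of the cubic remainder by
  -- `B` leaves a multiple of the second moment.
  have hq : ∀ x, ‖Complex.exp ((s * h x : ℝ) * Complex.I) -
      ((1 - s ^ 2 / 2 * h x ^ 2 : ℝ) + (s * h x : ℝ) * Complex.I)‖ ≤ |s| ^ 3 * B * h x ^ 2 := by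
    intro x
    have hn : ‖((s * h x : ℝ) : ℂ) * Complex.I‖ = |s| * |h x| := by
      rw [norm_mul, Complex.norm_I, mul_one, Complex.norm_real, Real.norm_eq_abs, abs_mul]
    have hle : ‖((s * h x : ℝ) : ℂ) * Complex.I‖ ≤ 1 := by
      rw [hn]
      exact (mul_le_mul_of_nonneg_left (hB x) (abs_nonneg s)).trans hs
    have hb := Complex.exp_bound hle (n := 3) (by norm_num)
    have hsum : ∑ m ∈ Finset.range 3, (((s * h x : ℝ) : ℂ) * Complex.I) ^ m / (m.factorial : ℂ) =
        ((1 - s ^ 2 / 2 * h x ^ 2 : ℝ) + (s * h x : ℝ) * Complex.I) := by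
      simp only [Finset.sum_range_succ, Finset.sum_range_zero, Nat.factorial]
      push_cast
      rw [mul_pow _ Complex.I 2, Complex.I_sq]
      ring
    rw [hsum, hn] at hb
    refine hb.trans ?_
    -- The constant of `Complex.exp_bound` is `4 / (3! * 3) = 2/9`.
    have hc : (((Nat.succ 3 : ℕ) : ℝ) * (((Nat.factorial 3 : ℕ) : ℝ) * ((3 : ℕ) : ℝ))⁻¹) ≤ 1 := by
      norm_num [Nat.factorial]
    calc (|s| * |h x|) ^ 3 * (((Nat.succ 3 : ℕ) : ℝ) * (((Nat.factorial 3 : ℕ) : ℝ) *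
          ((3 : ℕ) : ℝ))⁻¹) ≤ (|s| * |h x|) ^ 3 * 1 := by gcongr
      _ = |s| ^ 3 * |h x| * h x ^ 2 := by rw [← sq_abs (h x)]; ring
      _ ≤ |s| ^ 3 * B * h x ^ 2 := by gcongr; exact hB x
  have hexp : Integrable (fun x => Complex.exp ((s * h x : ℝ) * Complex.I)) μ :=
    .of_bound (by fun_prop) 1 (ae_of_all _ fun x => by rw [Complex.norm_exp_ofReal_mul_I])
  have hpoly1 : Integrable (fun x => ((1 - s ^ 2 / 2 * h x ^ 2 : ℝ) : ℂ)) μ :=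
    ((integrable_const _).sub (hint2.const_mul _)).ofReal
  have hpoly2 : Integrable (fun x => ((s * h x : ℝ) : ℂ) * Complex.I) μ :=
    (hint.const_mul s).ofReal.mul_const _
  -- The linear term may be inserted because `h` is centred.
  have heq : ((1 - s ^ 2 / 2 * ∫ x, h x ^ 2 ∂μ : ℝ) : ℂ) =
      ∫ x, (((1 - s ^ 2 / 2 * h x ^ 2 : ℝ) : ℂ) + ((s * h x : ℝ) : ℂ) * Complex.I) ∂μ := by
    have hr1 := integral_ofReal (𝕜 := ℂ) (μ := μ) (f := fun x => 1 - s ^ 2 / 2 * h x ^ 2)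
    have hr2 := integral_ofReal (𝕜 := ℂ) (μ := μ) (f := fun x => s * h x)
    simp only [Complex.coe_algebraMap] at hr1 hr2
    rw [integral_add hpoly1 hpoly2, integral_mul_const, hr1, hr2,
      integral_const_mul, h0, integral_sub (integrable_const _) (hint2.const_mul _),
      integral_const_mul]
    simp
  have hpoly : Integrable (fun x => ((1 - s ^ 2 / 2 * h x ^ 2 : ℝ) : ℂ) +
      ((s * h x : ℝ) : ℂ) * Complex.I) μ := hpoly1.add hpoly2
  rw [heq, ← integral_sub hexp hpoly, ← integral_const_mul]
  exact norm_integral_le_of_norm_le (hint2.const_mul _) (ae_of_all _ hq)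

/-- Independence factorizes the characteristic function at 1, and the `n` factors coincide since the
laws do. -/
theorem integral_exp_scaledSum [IsProbabilityMeasure P]
    (hX : ∀ j, Measurable (X j)) (hind : iIndepFun X P)
    (hlaw : ∀ j, P.map (X j) = μ) {g : α → ℝ} (hg : Measurable g) (n k : ℕ) :
    ∫ ω, Complex.exp ((scaledSum μ X g n k ω : ℝ) * Complex.I) ∂P =
      (∫ x, Complex.exp (((√(k : ℝ))⁻¹ * (g x - ∫ x, g x ∂μ) : ℝ) * Complex.I) ∂μ) ^ n := by
  set m := ∫ x, g x ∂μ with hm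
  have hφ : Measurable fun x => (√(k : ℝ))⁻¹ * (g x - m) := by fun_prop
  have hind' : iIndepFun (fun j ω => (√(k : ℝ))⁻¹ * (g (X j ω) - m)) P :=
    hind.comp (fun _ x => (√(k : ℝ))⁻¹ * (g x - m)) fun _ => hφ
  have hchar (Y : Ω → ℝ) (hY : Measurable Y) :
      charFun (P.map Y) 1 = ∫ ω, Complex.exp ((Y ω : ℝ) * Complex.I) ∂P := by
    rw [charFun_apply_real, integral_map hY.aemeasurable (by fun_prop)]
    simp
  rw [← hchar _ (measurable_scaledSum hX hg n k)]
  have : scaledSum μ X g n k = fun ω => ∑ j ∈ Finset.range n, (√(k : ℝ))⁻¹ * (g (X j ω) - m) := by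
    ext ω
    rw [scaledSum, Finset.mul_sum]
  rw [this, (hind'.restrict _).charFun_map_fun_finsetSum_eq_prod (fun j _ => by fun_prop),
    Finset.prod_apply, Finset.prod_congr rfl fun j _ => ?_, Finset.prod_const, Finset.card_range]
  rw [hchar _ (by fun_prop), ← hlaw j, integral_map (hX j).aemeasurable (by fun_prop)]

/-- Central limit theorem, in terms of characteristic functions, for the scaled sums of a uniformly
bounded sequence of functions whose variances are asymptotic to `Q * k / n`. -/
theorem tendsto_integral_exp_scaledSum [IsProbabilityMeasure P] [IsProbabilityMeasure μ]
    (hX : ∀ j, Measurable (X j)) (hind : iIndepFun X P) (hlaw : ∀ j, P.map (X j) = μ)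
    {g : ℕ → α → ℝ} (hg : ∀ n, Measurable (g n)) {B : ℝ} (hB : ∀ n x, |g n x| ≤ B)
    {k : ℕ → ℕ} (hk : Tendsto k atTop atTop) {Q : ℝ}
    (hQ : Tendsto (fun n : ℕ => (n : ℝ) / k n * ∫ x, (g n x - ∫ x, g n x ∂μ) ^ 2 ∂μ) atTop (𝓝 Q)) :
    Tendsto (fun n => ∫ ω, Complex.exp ((scaledSum μ X (g n) n (k n) ω : ℝ) * Complex.I) ∂P)
      atTop (𝓝 (Complex.exp (-(Q / 2 : ℝ)))) := by
  simp_rw [integral_exp_scaledSum hX hind hlaw (hg _)]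
  set v : ℕ → ℝ := fun n => ∫ x, (g n x - ∫ x, g n x ∂μ) ^ 2 ∂μ with hv
  have hs0 : Tendsto (fun n => (√(k n : ℝ))⁻¹) atTop (𝓝 0) :=
    tendsto_inv_atTop_zero.comp (Real.tendsto_sqrt_atTop.comp (tendsto_natCast_atTop_atTop.comp hk))
  have hbound : ∀ n x, |g n x - ∫ x, g n x ∂μ| ≤ 2 * B := fun n x => by
    have : |∫ x, g n x ∂μ| ≤ B := by
      simpa using norm_integral_le_of_norm_le_const (μ := μ) (f := g n) (ae_of_all _ (hB n))
    refine (abs_sub _ _).trans ?_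
    linarith [hB n x]
  have hmean : ∀ n, ∫ x, (g n x - ∫ x, g n x ∂μ) ∂μ = 0 := fun n => by
    rw [integral_sub (integrable_of_abs_le (hg n) (hB n)) (integrable_const _)]
    simp
  apply Complex.tendsto_pow_exp_of_isLittleO_sub_add_div
  -- This is `n` times the bound on the distance from the one-summand characteristic function to `1
  -- - Q/(2n)`: the cubic remainder, smaller by a factor `1/√k`, plus the error in the variance.
  have hreal : Tendsto (fun n : ℕ => ((n : ℝ) / k n * v n) * ((√(k n : ℝ))⁻¹ * (2 * B)) +
      |((n : ℝ) / k n * v n) - Q| / 2) atTop (𝓝 0) := by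
    have h1 := hQ.mul (hs0.mul_const (2 * B))
    have h2 := ((hQ.sub_const Q).abs.div_const 2)
    simpa using h1.add h2
  rw [isLittleO_iff]
  intro c hc
  have hsB : ∀ᶠ n in atTop, |(√(k n : ℝ))⁻¹| * (2 * B) ≤ 1 := by
    have := (hs0.abs.mul_const (2 * B))
    rw [abs_zero, zero_mul] at this
    exact this.eventually_le_const one_pos
  filter_upwards [hreal.eventually_le_const hc, hsB, eventually_ge_atTop 1,
    hk.eventually_ge_atTop 1] with n h1 h2 hn hkn
  have hn0 : (0 : ℝ) < n := by exact_mod_cast hn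
  have hk0 : (0 : ℝ) < k n := by exact_mod_cast hkn
  have hexp := norm_integral_exp_sub_le (μ := μ) (h := fun x => g n x - ∫ x, g n x ∂μ)
    (by have := hg n; fun_prop) (hbound n) (hmean n) h2
  have hsq : ((√(k n : ℝ))⁻¹) ^ 2 = (k n : ℝ)⁻¹ := by
    rw [inv_pow, Real.sq_sqrt hk0.le]
  have hdiff : ‖((1 - ((√(k n : ℝ))⁻¹) ^ 2 / 2 * v n : ℝ) : ℂ) -
      (1 + (-(Q / 2 : ℝ) : ℂ) / n)‖ = |((n : ℝ) / k n * v n) - Q| / 2 / n := by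
    have : ((1 - ((√(k n : ℝ))⁻¹) ^ 2 / 2 * v n : ℝ) : ℂ) - (1 + (-(Q / 2 : ℝ) : ℂ) / n) =
        ((-((((n : ℝ) / k n * v n) - Q) / 2 / n) : ℝ) : ℂ) := by
      rw [hsq]
      push_cast
      have : (n : ℂ) ≠ 0 := by exact_mod_cast hn0.ne'
      have : (k n : ℂ) ≠ 0 := by exact_mod_cast hk0.ne'
      field_simp
      ring
    rw [this, Complex.norm_real, Real.norm_eq_abs, abs_neg, abs_div, abs_div, abs_two,
      abs_of_pos hn0]
  rw [← sub_add_sub_cancel _ ((1 - ((√(k n : ℝ))⁻¹) ^ 2 / 2 * v n : ℝ) : ℂ)]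
  refine (norm_add_le _ _).trans ?_
  rw [hdiff]
  refine (add_le_add_left hexp _).trans ?_
  rw [norm_div, norm_one, Complex.norm_natCast, ← mul_div_assoc, mul_one, le_div_iff₀ hn0]
  refine le_trans (le_of_eq ?_) h1
  rw [pow_succ, sq_abs, hsq, abs_of_nonneg (by positivity)]
  change ((k n : ℝ)⁻¹ * _ * _ * v n + _) * _ = _
  field_simp

end scaledSum

/-! ### Moments of exceedance indicators -/

/-- The indicator of the event that the `i`-th coordinate exceeds `c`. -/
noncomputable def exceed {d : ℕ} (i : Fin d) (c : ℝ) (x : Fin d → ℝ) : ℝ :=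
  Set.indicator (Set.Ioi c) 1 (x i)

section exceed

variable {d : ℕ}

theorem exceed_eq_ite (i : Fin d) (c : ℝ) (x : Fin d → ℝ) :
    exceed i c x = if c < x i then 1 else 0 := by
  simp [exceed, Set.indicator_apply]

theorem measurable_exceed (i : Fin d) (c : ℝ) : Measurable (exceed i c) :=
  (measurable_one.indicator measurableSet_Ioi).comp (measurable_pi_apply i)

theorem exceed_mul_self (i : Fin d) (c : ℝ) (x : Fin d → ℝ) :
    exceed i c x * exceed i c x = exceed i c x := by
  rw [exceed_eq_ite]; split_ifs <;> simp

theorem abs_exceed_le (i : Fin d) (c : ℝ) (x : Fin d → ℝ) : |exceed i c x| ≤ 1 := by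
  rw [exceed_eq_ite]; split_ifs <;> simp

theorem abs_exceed_sub_exceed_le (i : Fin d) (a b : ℝ) (x : Fin d → ℝ) :
    |exceed i a x - exceed i b x| ≤ 1 := by
  simp only [exceed_eq_ite]; split_ifs <;> simp

variable {μ : Measure (Fin d → ℝ)}

theorem integral_exceed (hμ : ∀ i, μ.map (fun x => x i) = volume.restrict (Set.Icc (0 : ℝ) 1))
    (i : Fin d) {s : ℝ} (h0 : 0 ≤ s) (h1 : s ≤ 1) : ∫ x, exceed i (1 - s) x ∂μ = s := by
  have hinter : Set.Ioi (1 - s) ∩ Set.Icc (0 : ℝ) 1 = Set.Ioc (1 - s) 1 := by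
    ext y
    simp only [Set.mem_inter_iff, Set.mem_Ioi, Set.mem_Icc, Set.mem_Ioc]
    constructor
    · rintro ⟨h, -, h'⟩; exact ⟨h, h'⟩
    · rintro ⟨h, h'⟩; exact ⟨h, by linarith, h'⟩
  have hmap := integral_map (μ := μ) (φ := fun x => x i) (measurable_pi_apply i).aemeasurable
    (f := Set.indicator (Set.Ioi (1 - s)) (1 : ℝ → ℝ))
    (measurable_one.indicator measurableSet_Ioi).aestronglyMeasurable
  unfold exceed
  rw [← hmap, hμ i, integral_indicator_one measurableSet_Ioi,
    measureReal_restrict_apply measurableSet_Ioi, hinter, Real.volume_real_Ioc_of_le (by linarith)]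
  ring

variable [IsProbabilityMeasure μ]

theorem integrable_exceed (i : Fin d) (c : ℝ) : Integrable (exceed i c) μ :=
  integrable_of_abs_le (measurable_exceed i c) (abs_exceed_le i c)

theorem integrable_exceed_mul_exceed (i j : Fin d) (a b : ℝ) :
    Integrable (fun x => exceed i a x * exceed j b x) μ :=
  integrable_of_abs_le (B := 1) ((measurable_exceed i a).mul (measurable_exceed j b)) fun x => by
    simp only [exceed_eq_ite]; split_ifs <;> simp

/-- The two events are nested, so the difference is, up to sign, itself an indicator and equals its
own square. -/
theorem integral_sq_exceed_sub_exceed (i : Fin d) (a b : ℝ) :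
    ∫ x, (exceed i a x - exceed i b x) ^ 2 ∂μ =
      |∫ x, exceed i a x ∂μ - ∫ x, exceed i b x ∂μ| := by
  wlog hab : a ≤ b generalizing a b
  · rw [abs_sub_comm, ← this b a (le_of_not_ge hab)]
    simp_rw [← neg_sub (exceed i b _), neg_sq]
  have h0 : ∀ x, 0 ≤ exceed i a x - exceed i b x := fun x => by
    simp only [exceed_eq_ite]; split_ifs <;> first | (exfalso; linarith) | norm_num
  have hsq : ∀ x, (exceed i a x - exceed i b x) ^ 2 = exceed i a x - exceed i b x := fun x => by
    simp only [exceed_eq_ite]; split_ifs <;> first | (exfalso; linarith) | norm_num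
  simp_rw [hsq]
  rw [← integral_sub (integrable_exceed i a) (integrable_exceed i b),
    abs_of_nonneg (integral_nonneg h0)]

/-- Inclusion-exclusion: the event that neither coordinate exceeds `1 - s` is, up to a null set, a
lower orthant, whose measure is a value of the distribution function. -/
theorem integral_exceed_mul_exceed
    (hμ : ∀ i, μ.map (fun x => x i) = volume.restrict (Set.Icc (0 : ℝ) 1))
    {i j : Fin d} (hij : i ≠ j) {s : ℝ} (h0 : 0 ≤ s) (h1 : s ≤ 1) :
    ∫ x, exceed i (1 - s) x * exceed j (1 - s) x ∂μ =
      2 * s - 1 + μ.real (Set.Iic (1 - s • (Pi.single i 1 + Pi.single j 1))) := by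
  -- Coordinates other than `i` and `j` have bound 1 in the orthant, which is almost surely no
  -- constraint.
  have hle : ∀ᵐ x ∂μ, ∀ l, x l ≤ 1 := ae_all_iff.2 fun l => by
    have : ∀ᵐ y ∂(μ.map fun x => x l), y ≤ 1 := by
      rw [hμ l]
      exact (ae_restrict_mem measurableSet_Icc).mono fun y hy => hy.2
    exact ae_of_ae_map (measurable_pi_apply l).aemeasurable this
  set u : Fin d → ℝ := 1 - s • (Pi.single i 1 + Pi.single j 1) with hu
  have hind : (fun x => (1 - exceed i (1 - s) x) * (1 - exceed j (1 - s) x)) =ᵐ[μ]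
      Set.indicator (Set.Iic u) 1 := by
    filter_upwards [hle] with x hx
    have hmem : x ∈ Set.Iic u ↔ x i ≤ 1 - s ∧ x j ≤ 1 - s := by
      rw [Set.mem_Iic, Pi.le_def, hu]
      constructor
      · intro h
        have hi := h i
        have hj := h j
        simp [hij, hij.symm] at hi hj
        exact ⟨hi, hj⟩
      · rintro ⟨hi, hj⟩ l
        by_cases hli : l = i
        · subst hli; simpa [hij] using hi
        by_cases hlj : l = j
        · subst hlj; simpa [hij.symm] using hj
        · simpa [hli, hlj] using hx l
    by_cases hi : x i ≤ 1 - s <;> by_cases hj : x j ≤ 1 - s <;>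
      simp [exceed_eq_ite, Set.indicator, hmem, hi, hj, not_lt.2, not_le.1]
  have hI := integral_congr_ae hind
  rw [integral_indicator_one measurableSet_Iic] at hI
  have hexp : ∀ x, (1 - exceed i (1 - s) x) * (1 - exceed j (1 - s) x) =
      1 - exceed i (1 - s) x - exceed j (1 - s) x + exceed i (1 - s) x * exceed j (1 - s) x :=
    fun x => by ring
  have hi1 : Integrable (fun x => 1 - exceed i (1 - s) x) μ :=
    (integrable_const _).sub (integrable_exceed i _)
  have hi2 : Integrable (fun x => 1 - exceed i (1 - s) x - exceed j (1 - s) x) μ :=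
    hi1.sub (integrable_exceed j _)
  simp_rw [hexp] at hI
  rw [integral_add hi2 (integrable_exceed_mul_exceed i j _ _),
    integral_sub hi1 (integrable_exceed j _), integral_sub (integrable_const _)
    (integrable_exceed i _), integral_exceed hμ i h0 h1, integral_exceed hμ j h0 h1] at hI
  rw [integral_const, probReal_univ, one_smul] at hI
  linarith

end exceed

/-! ### Tail dependence and the limiting covariance -/

theorem IsDNorm.apply_smul {d : ℕ} {N : (Fin d → ℝ) → ℝ} (hN : IsDNorm N) {s : ℝ} (hs : 0 ≤ s)
    (x : Fin d → ℝ) : N (s • x) = s * N x := by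
  obtain ⟨ν, -, -, -, h⟩ := hN
  rw [h, h, ← integral_const_mul]
  simp_rw [Real.mul_iSup_of_nonneg hs, Pi.smul_apply, smul_eq_mul, abs_mul, abs_of_nonneg hs,
    mul_assoc]

/-- The tail dependence coefficients of a copula with a `D`-norm expansion. -/
theorem tendsto_integral_exceed_mul_exceed {d : ℕ} {μ : Measure (Fin d → ℝ)}
    [IsProbabilityMeasure μ]
    (hμ : ∀ i, μ.map (fun x => x i) = volume.restrict (Set.Icc (0 : ℝ) 1))
    {C N : (Fin d → ℝ) → ℝ} (hC : ∀ u, C u = μ.real (Set.Iic u)) (hN : IsDNorm N)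
    (hCN : HasDNormExpansion C N) (i j : Fin d) :
    Tendsto (fun s : ℝ => s⁻¹ * ∫ x, exceed i (1 - s) x * exceed j (1 - s) x ∂μ) (𝓝[>] 0)
      (𝓝 (asymptoticCov N i j)) := by
  have hIoc : Set.Ioc (0 : ℝ) 1 ∈ 𝓝[>] (0 : ℝ) := Ioc_mem_nhdsGT one_pos
  rcases eq_or_ne i j with rfl | hij
  · refine tendsto_const_nhds.congr' ?_
    filter_upwards [hIoc] with s hs
    simp_rw [exceed_mul_self]
    rw [integral_exceed hμ i hs.1.le hs.2, inv_mul_cancel₀ hs.1.ne']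
    simp [asymptoticCov]
  set e : Fin d → ℝ := Pi.single i 1 + Pi.single j 1 with he
  have he0 : 0 ≤ e := add_nonneg (Pi.single_nonneg.2 zero_le_one) (Pi.single_nonneg.2 zero_le_one)
  have he1 : e ≤ 1 := fun l => by
    by_cases hli : l = i
    · subst hli; simp [he, hij]
    · by_cases hlj : l = j
      · subst hlj; simp [he, hij.symm]
      · simp [he, hli, hlj]
  have hu : Tendsto (fun s : ℝ => 1 - s • e) (𝓝[>] 0) (𝓝[Set.Icc 0 1] 1) := by
    refine tendsto_nhdsWithin_iff.2 ⟨?_, ?_⟩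
    · have : Tendsto (fun s : ℝ => 1 - s • e) (𝓝 0) (𝓝 (1 - (0 : ℝ) • e)) :=
        Continuous.tendsto (by fun_prop) 0
      rw [zero_smul, sub_zero] at this
      exact this.mono_left nhdsWithin_le_nhds
    · filter_upwards [hIoc] with s hs
      refine ⟨fun l => ?_, fun l => ?_⟩
      · have h1 := he1 l
        have h0 := he0 l
        simp only [Pi.zero_apply, Pi.one_apply, Pi.sub_apply, Pi.smul_apply, smul_eq_mul] at *
        nlinarith [hs.1, hs.2]
      · have h0 := he0 l
        simp only [Pi.zero_apply, Pi.one_apply, Pi.sub_apply, Pi.smul_apply, smul_eq_mul] at *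
        nlinarith [hs.1, hs.2]
  have hlit : (fun s : ℝ => C (1 - s • e) - (1 - s * N e)) =o[𝓝[>] 0] fun s : ℝ => s := by
    have h := hCN.comp_tendsto hu
    have h' : (fun s : ℝ => C (1 - s • e) - (1 - s * N e)) =o[𝓝[>] 0] fun s : ℝ => ‖s • e‖ := by
      refine h.congr' ?_ (Eventually.of_forall fun s => by simp)
      filter_upwards [hIoc] with s hs
      simp [hN.apply_smul hs.1.le]
    refine h'.trans_isBigO (IsBigO.of_bound ‖e‖ (Eventually.of_forall fun s => ?_))
    rw [norm_norm, norm_smul, mul_comm]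
  have hlim := (isLittleO_iff_tendsto' (by
    filter_upwards [hIoc] with s hs h using absurd h hs.1.ne')).1 hlit
  -- By inclusion-exclusion the rescaled joint exceedance probability is `s⁻¹ (2s - 1 + C (1 - s •
  -- e))`, that is, `2 - N e` plus the remainder of the expansion divided by `s`.
  have hlim2 := hlim.add_const (2 - N e)
  rw [zero_add] at hlim2
  have hcov : asymptoticCov N i j = 2 - N e := by simp [asymptoticCov, hij, he]
  rw [hcov]
  refine hlim2.congr' ?_
  filter_upwards [hIoc] with s hs
  have := hs.1.ne'
  rw [integral_exceed_mul_exceed hμ hij hs.1.le hs.2, ← he, ← hC]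
  field_simp
  ring

/-- Asymptotic variance of the linear combinations of exceedance indicators. -/
theorem tendsto_variance_sum_exceed {d : ℕ} {μ : Measure (Fin d → ℝ)} [IsProbabilityMeasure μ]
    (hμ : ∀ i, μ.map (fun x => x i) = volume.restrict (Set.Icc (0 : ℝ) 1))
    {C N : (Fin d → ℝ) → ℝ} (hC : ∀ u, C u = μ.real (Set.Iic u)) (hN : IsDNorm N)
    (hCN : HasDNormExpansion C N) (t : Fin d → ℝ) :
    Tendsto (fun s : ℝ => s⁻¹ * ∫ x, (∑ i, t i * exceed i (1 - s) x -
        ∫ x, ∑ i, t i * exceed i (1 - s) x ∂μ) ^ 2 ∂μ) (𝓝[>] 0)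
      (𝓝 (t ⬝ᵥ (asymptoticCov N).mulVec t)) := by
  -- The term with factor 0 is the limit of `s (∑ t_i)²`, the squared mean divided by `s`.
  have hQ : t ⬝ᵥ (asymptoticCov N).mulVec t =
      ∑ i, ∑ j, t i * t j * asymptoticCov N i j - 0 * (∑ i, t i) ^ 2 := by
    simp only [dotProduct, Matrix.mulVec, Finset.mul_sum, zero_mul, sub_zero]
    exact Finset.sum_congr rfl fun i _ => Finset.sum_congr rfl fun j _ => by ring
  rw [hQ]
  have hmain := (tendsto_finsetSum Finset.univ fun i _ => tendsto_finsetSum Finset.univ fun j _ =>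
    (tendsto_integral_exceed_mul_exceed hμ hC hN hCN i j).const_mul (t i * t j)).sub
    ((tendsto_id.mono_left nhdsWithin_le_nhds : Tendsto id (𝓝[>] (0 : ℝ)) (𝓝 0)).mul_const
      ((∑ i, t i) ^ 2))
  refine hmain.congr' ?_
  filter_upwards [Ioc_mem_nhdsGT (one_pos : (0 : ℝ) < 1)] with s hs
  have hint1 : Integrable (fun x => ∑ i, t i * exceed i (1 - s) x) μ :=
    integrable_finsetSum _ fun i _ => (integrable_exceed i _).const_mul _
  have hmean : ∫ x, ∑ i, t i * exceed i (1 - s) x ∂μ = s * ∑ i, t i := by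
    rw [integral_finsetSum _ fun i _ => (integrable_exceed i _).const_mul _]
    simp_rw [integral_const_mul, integral_exceed hμ _ hs.1.le hs.2, mul_comm (t _),
      ← Finset.mul_sum]
  have hint2 : ∀ i j : Fin d,
      Integrable (fun x => t i * t j * (exceed i (1 - s) x * exceed j (1 - s) x)) μ :=
    fun i j => (integrable_exceed_mul_exceed i j _ _).const_mul _
  have hint3 : Integrable
      (fun x => ∑ i, ∑ j, t i * t j * (exceed i (1 - s) x * exceed j (1 - s) x)) μ :=
    integrable_finsetSum _ fun i _ => integrable_finsetSum _ fun j _ => hint2 i j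
  set m := s * ∑ i, t i with hm
  have hexp : ∀ x, (∑ i, t i * exceed i (1 - s) x - m) ^ 2 =
      ∑ i, ∑ j, t i * t j * (exceed i (1 - s) x * exceed j (1 - s) x) -
        2 * m * ∑ i, t i * exceed i (1 - s) x + m ^ 2 := fun x => by
    have : ∑ i, ∑ j, t i * t j * (exceed i (1 - s) x * exceed j (1 - s) x) =
        (∑ i, t i * exceed i (1 - s) x) ^ 2 := by
      rw [sq, Finset.sum_mul_sum]
      exact Finset.sum_congr rfl fun i _ => Finset.sum_congr rfl fun j _ => by ring
    rw [this]
    ring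
  have hint4 : Integrable (fun x => 2 * m * ∑ i, t i * exceed i (1 - s) x) μ := hint1.const_mul _
  have hint5 : Integrable
      (fun x => ∑ i, ∑ j, t i * t j * (exceed i (1 - s) x * exceed j (1 - s) x) -
        2 * m * ∑ i, t i * exceed i (1 - s) x) μ := hint3.sub hint4
  rw [hmean]
  simp_rw [hexp]
  rw [integral_add hint5 (integrable_const _), integral_sub hint3 hint4, integral_const_mul, hmean,
    integral_finsetSum _ fun i _ => integrable_finsetSum _ fun j _ => hint2 i j]
  simp_rw [integral_finsetSum _ fun j (_ : j ∈ Finset.univ) => hint2 _ j, integral_const_mul]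
  rw [integral_const, probReal_univ, one_smul]
  have hs0 := hs.1.ne'
  simp only [id_eq, hm]
  simp_rw [mul_left_comm _ s⁻¹, ← Finset.mul_sum]
  field_simp
  ring

/-- The quadratic form at `t` is a limit of variances multiplied by `s⁻¹ > 0`. -/
theorem posSemidef_asymptoticCov {d : ℕ} {C N : (Fin d → ℝ) → ℝ} (hC : IsCopula C)
    (hN : IsDNorm N) (hCN : HasDNormExpansion C N) : (asymptoticCov N).PosSemidef := by
  obtain ⟨μ, hμp, hμ, hCμ⟩ := hC
  refine Matrix.PosSemidef.of_dotProduct_mulVec_nonneg ?_ fun t => ?_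
  · ext i j
    simp [asymptoticCov, eq_comm, add_comm]
  · rw [star_trivial]
    refine ge_of_tendsto (tendsto_variance_sum_exceed hμ hCμ hN hCN t) ?_
    filter_upwards [self_mem_nhdsWithin] with s hs
    exact mul_nonneg (inv_nonneg.2 (le_of_lt hs)) (integral_nonneg fun x => sq_nonneg _)

/-! ### From exceedance counts to order statistics -/

/-- Reduces convergence in probability of vectors to that of coordinates. The `+ 1` avoids a zero
denominator for an empty index type, and `(d + 1)² > d` gives the contradiction. -/
theorem EuclideanSpace.exists_le_abs_of_le_norm {ι : Type*} [Fintype ι] {x : EuclideanSpace ℝ ι}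
    {ε : ℝ} (hε : 0 < ε) (hx : ε ≤ ‖x‖) : ∃ i, ε / (Fintype.card ι + 1) ≤ |x i| := by
  by_contra! h
  set δ := ε / (Fintype.card ι + 1) with hδ
  have hd : (0 : ℝ) ≤ Fintype.card ι := Nat.cast_nonneg _
  have hδ0 : 0 < δ := by positivity
  have hεδ : ε = (Fintype.card ι + 1) * δ := by rw [hδ]; field_simp
  have h1 : ‖x‖ ^ 2 ≤ Fintype.card ι * δ ^ 2 := by
    rw [EuclideanSpace.norm_sq_eq]
    calc ∑ i, ‖x i‖ ^ 2 ≤ ∑ _i : ι, δ ^ 2 := Finset.sum_le_sum fun i _ => by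
          have := (h i).le
          rw [Real.norm_eq_abs]
          gcongr
      _ = Fintype.card ι * δ ^ 2 := by simp
  have h2 : ε ^ 2 ≤ ‖x‖ ^ 2 := by gcongr
  rw [hεδ] at h2
  nlinarith [sq_pos_of_pos hδ0, mul_nonneg hd (sq_nonneg δ),
    mul_nonneg (mul_nonneg hd hd) (sq_nonneg δ)]

theorem measurable_normalizedIntermediateOS {d : ℕ} {Ω : Type*} [MeasurableSpace Ω]
    {X : ℕ → Ω → Fin d → ℝ} (hXm : ∀ j, Measurable (X j)) (n m : ℕ) :
    Measurable (normalizedIntermediateOS X n m) := by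
  refine (WithLp.measurable_toLp 2 _).comp (measurable_pi_lambda _ fun i => ?_)
  refine Measurable.const_mul (Measurable.sub_const ?_ _) _
  exact (measurable_orderStat (n - m)).comp (measurable_pi_lambda _ fun j =>
    (measurable_pi_apply i).comp (hXm j))

/-- A normalized intermediate order statistic is at most `y` iff the scaled exceedance count over
the corresponding level is. -/
theorem normalizedIntermediateOS_le_iff {d : ℕ} {Ω : Type*} {μ : Measure (Fin d → ℝ)}
    {X : ℕ → Ω → Fin d → ℝ} {n m : ℕ} (hm : 1 ≤ m) (hmn : m < n) {i : Fin d} {y : ℝ}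
    (hp : ∫ x, exceed i (1 - (m - y * √m) / n) x ∂μ = (m - y * √m) / n) (ω : Ω) :
    normalizedIntermediateOS X n m ω i ≤ y ↔
      scaledSum μ X (exceed i (1 - (m - y * √m) / n)) n m ω ≤ y := by
  have hn0 : (0 : ℝ) < n := by exact_mod_cast (by omega : 0 < n)
  have hm0 : (0 : ℝ) < √m := Real.sqrt_pos.2 (by exact_mod_cast hm)
  have hsq : √(m : ℝ) * √m = m := Real.mul_self_sqrt (Nat.cast_nonneg _)
  have h1 : normalizedIntermediateOS X n m ω i ≤ y ↔
      orderStat (fun j : Fin n => X j ω i) (n - m) ≤ 1 - (m - y * √m) / n := by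
    simp only [normalizedIntermediateOS]
    rw [← le_div_iff₀' (by positivity), sub_le_iff_le_add]
    have : y / ((n : ℝ) / √m) + ((n : ℝ) - m) / n = 1 - (m - y * √m) / n := by
      field_simp
      ring
    rw [this]
  -- The count has mean `m - y√m`, so the threshold `y√m` for the centred count becomes `m` for the
  -- count itself.
  have h2 : scaledSum μ X (exceed i (1 - (m - y * √m) / n)) n m ω ≤ y ↔
      ∑ j ∈ Finset.range n, exceed i (1 - (m - y * √m) / n) (X j ω) ≤ m := by
    rw [scaledSum, hp, Finset.sum_sub_distrib, Finset.sum_const, Finset.card_range, nsmul_eq_mul,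
      mul_div_cancel₀ _ hn0.ne', inv_mul_le_iff₀ hm0]
    constructor <;> intro h <;> linarith
  rw [h1, h2, orderStat_le_iff _ (by omega) (by omega), Nat.sub_sub_self hmn.le,
    Finset.sum_range fun j => exceed i (1 - (m - y * √m) / n) (X j ω)]
  simp_rw [exceed_eq_ite, Finset.sum_boole]
  exact Nat.cast_le.symm

section Sample

variable {d : ℕ} {Ω : Type*} [MeasurableSpace Ω] {P : Measure Ω} [IsProbabilityMeasure P]
  {μ : Measure (Fin d → ℝ)} [IsProbabilityMeasure μ] {X : ℕ → Ω → Fin d → ℝ} {k : ℕ → ℕ}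

/-- The scaled exceedance counts over the level `1 - k / n` are asymptotically normal. -/
theorem tendstoInDistribution_scaledSum_exceed
    (hμ : ∀ i, μ.map (fun x => x i) = volume.restrict (Set.Icc (0 : ℝ) 1))
    {C N : (Fin d → ℝ) → ℝ} (hC : ∀ u, C u = μ.real (Set.Iic u)) (hN : IsDNorm N)
    (hCN : HasDNormExpansion C N) (hXm : ∀ j, Measurable (X j)) (hXi : iIndepFun X P)
    (hlaw : ∀ j, P.map (X j) = μ) (hk_top : Tendsto k atTop atTop)
    (hk_div : Tendsto (fun n => (k n : ℝ) / (n : ℝ)) atTop (𝓝 0)) :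
    TendstoInDistribution
      (fun n ω => WithLp.toLp 2 fun i => scaledSum μ X (exceed i (1 - k n / n)) n (k n) ω) atTop
      (id : EuclideanSpace ℝ (Fin d) → EuclideanSpace ℝ (Fin d)) (fun _ => P)
      (multivariateGaussian 0 (asymptoticCov N)) := by
  have hmeas : ∀ n, Measurable fun ω => (WithLp.toLp 2 fun i =>
      scaledSum μ X (exceed i (1 - k n / n)) n (k n) ω : EuclideanSpace ℝ (Fin d)) := fun n =>
    (WithLp.measurable_toLp 2 _).comp (measurable_pi_lambda _ fun i =>
      measurable_scaledSum hXm (measurable_exceed i _) _ _)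
  have hS := posSemidef_asymptoticCov ⟨μ, ‹_›, hμ, hC⟩ hN hCN
  refine ⟨fun n => (hmeas n).aemeasurable, by fun_prop, ?_⟩
  -- By linearity of scaled sums, the characteristic function at `t` is that of one scaled sum, of
  -- `∑ t_i exceed_i`, at 1; the one-dimensional limit theorem therefore suffices.
  refine ProbabilityMeasure.tendsto_of_tendsto_charFun fun t => ?_
  simp only [ProbabilityMeasure.coe_mk, Measure.map_id, charFun_multivariateGaussian hS]
  have hs : Tendsto (fun n => (k n : ℝ) / (n : ℝ)) atTop (𝓝[>] 0) := by
    refine tendsto_nhdsWithin_iff.2 ⟨hk_div, ?_⟩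
    filter_upwards [hk_top.eventually_ge_atTop 1, eventually_ge_atTop 1] with n h1 h2
    have h1' : (0 : ℝ) < k n := by exact_mod_cast h1
    have h2' : (0 : ℝ) < n := by exact_mod_cast h2
    exact div_pos h1' h2'
  have hQ := (tendsto_variance_sum_exceed hμ hC hN hCN t).comp hs
  simp only [Function.comp_def, inv_div] at hQ
  have hclt := tendsto_integral_exp_scaledSum hXm hXi hlaw
    (g := fun n x => ∑ i, t i * exceed i (1 - k n / n) x)
    (fun n => Finset.measurable_sum _ fun i _ => (measurable_exceed i _).const_mul _)
    (B := ∑ i, |t i|) (fun n x => (Finset.abs_sum_le_sum_abs _ _).trans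
      (Finset.sum_le_sum fun i _ => by
        rw [abs_mul]
        exact mul_le_of_le_one_right (abs_nonneg _) (abs_exceed_le i _ x))) hk_top hQ
  convert! hclt using 2 with n
  · rw [charFun_apply, integral_map (hmeas n).aemeasurable (by fun_prop)]
    refine integral_congr_ae (ae_of_all _ fun ω => ?_)
    simp only
    rw [← sum_mul_scaledSum Finset.univ fun i => integrable_exceed i _, PiLp.inner_apply]
    simp
  · simp

/-- Each normalized intermediate order statistic is asymptotically equal to the scaled exceedance
count over the level `1 - k / n`. -/
theorem tendsto_measure_normalizedIntermediateOS_sub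
    (hμ : ∀ i, μ.map (fun x => x i) = volume.restrict (Set.Icc (0 : ℝ) 1))
    (hXm : ∀ j, Measurable (X j)) (hXi : iIndepFun X P)
    (hlaw : ∀ j, P.map (X j) = μ) (hk : ∀ n, 2 ≤ n → 1 ≤ k n ∧ k n ≤ n - 1)
    (hk_top : Tendsto k atTop atTop)
    (hk_div : Tendsto (fun n => (k n : ℝ) / (n : ℝ)) atTop (𝓝 0)) (i : Fin d) {ε : ℝ}
    (hε : 0 < ε) :
    Tendsto (fun n => P {ω | ε ≤ |normalizedIntermediateOS X n (k n) ω i -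
      scaledSum μ X (exceed i (1 - k n / n)) n (k n) ω|}) atTop (𝓝 0) := by
  have hsqrt : Tendsto (fun n => √(k n : ℝ)) atTop atTop :=
    Real.tendsto_sqrt_atTop.comp (tendsto_natCast_atTop_atTop.comp hk_top)
  -- The uniform margin gives this once `(k - y√k)/n` lies in `[0, 1]`: `|y| ≤ √k` yields `0 ≤ k -
  -- y√k ≤ 2k`, and `k/n ≤ 1/2` yields `2k ≤ n`.
  have hp : ∀ y : ℝ, ∀ᶠ n in atTop,
      ∫ x, exceed i (1 - (k n - y * √(k n)) / n) x ∂μ = (k n - y * √(k n)) / n := fun y => by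
    filter_upwards [hsqrt.eventually_ge_atTop |y|, hk_div.eventually_le_const one_half_pos,
      eventually_ge_atTop 1] with n h1 h2 h3
    have hn0 : (0 : ℝ) < n := by exact_mod_cast h3
    have hsq : √(k n : ℝ) * √(k n) = k n := Real.mul_self_sqrt (Nat.cast_nonneg _)
    have h4 : |y * √(k n)| ≤ k n := by
      rw [abs_mul, abs_of_nonneg (Real.sqrt_nonneg _)]
      exact (mul_le_mul_of_nonneg_right h1 (Real.sqrt_nonneg _)).trans hsq.le
    obtain ⟨h5, h6⟩ := abs_le.1 h4
    rw [div_le_iff₀ hn0] at h2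
    refine integral_exceed hμ i (div_nonneg (by linarith) hn0.le) ((div_le_one hn0).2 ?_)
    linarith
  have hp0 := hp 0
  simp only [zero_mul, sub_zero] at hp0
  refine tendstoInMeasure_sub_of_le_iff
    (U := fun y n => scaledSum μ X (exceed i (1 - (k n - y * √(k n)) / n)) n (k n))
    (fun y => ?_) (fun y δ hδ => ?_) (fun η hη => ?_) hε
  · filter_upwards [hp y, eventually_ge_atTop 2] with n hn h2 ω
    obtain ⟨hk1, hk2⟩ := hk n h2
    exact normalizedIntermediateOS_le_iff hk1 (by omega) hn ω
  · have hlim : Tendsto (fun n => ENNReal.ofReal (|y| * (√(k n : ℝ))⁻¹ / δ ^ 2)) atTop (𝓝 0) := by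
      have := ((tendsto_inv_atTop_zero.comp hsqrt).const_mul |y|).div_const (δ ^ 2)
      rw [mul_zero, zero_div] at this
      simpa using ENNReal.tendsto_ofReal this
    refine tendsto_of_tendsto_of_tendsto_of_le_of_le' tendsto_const_nhds hlim
      (Eventually.of_forall fun _ => zero_le) ?_
    filter_upwards [hp y, hp0, eventually_ge_atTop 2] with n h1 h2 h3
    have hn0 : (0 : ℝ) < n := by exact_mod_cast (by omega : 0 < n)
    have hm0 : (0 : ℝ) < √(k n) := Real.sqrt_pos.2 (by exact_mod_cast (hk n h3).1)
    have hsq : √(k n : ℝ) ^ 2 = k n := Real.sq_sqrt (Nat.cast_nonneg _)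
    simp_rw [scaledSum_sub (integrable_exceed i _) (integrable_exceed i _)]
    refine (measure_le_abs_scaledSum_le hXm hXi hlaw
      ((measurable_exceed i _).sub (measurable_exceed i _)) (abs_exceed_sub_exceed_le i _ _)
      n (k n) hδ).trans (le_of_eq ?_)
    simp only [Pi.sub_apply]
    rw [integral_sq_exceed_sub_exceed, h1, h2]
    congr 2
    rw [← sub_div, sub_sub_cancel_left, abs_div, abs_neg, abs_mul, abs_of_pos hm0, abs_of_pos hn0]
    have hk0 : (0 : ℝ) < k n := hsq ▸ pow_pos hm0 2
    field_simp
    rw [hsq, mul_comm]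
  · rcases eq_or_ne η ⊤ with rfl | hη'
    · exact ⟨0, Eventually.of_forall fun _ => le_top⟩
    have hη0 := ENNReal.toReal_pos hη.ne' hη'
    -- The second moment of the indicator is `k/n`, so Chebyshev's bound at `M` is `M⁻²`, which
    -- equals `η` for this `M`.
    refine ⟨(√η.toReal)⁻¹, ?_⟩
    filter_upwards [hp0, eventually_ge_atTop 2] with n h2 h3
    have hn0 : (n : ℝ) ≠ 0 := by exact_mod_cast (by omega : n ≠ 0)
    have hm0 : (k n : ℝ) ≠ 0 := by exact_mod_cast (by have := (hk n h3).1; omega : k n ≠ 0)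
    refine (measure_le_abs_scaledSum_le hXm hXi hlaw (measurable_exceed i _) (abs_exceed_le i _)
      n (k n) (inv_pos.2 (Real.sqrt_pos.2 hη0))).trans (le_of_eq ?_)
    simp_rw [sq (exceed i _ _), exceed_mul_self]
    rw [h2, inv_pow, Real.sq_sqrt hη0.le, div_mul_div_comm, mul_comm (n : ℝ),
      div_self (mul_ne_zero hm0 hn0), one_div, inv_inv, ENNReal.ofReal_toReal hη']

end Sample

theorem corollary2p3 {d : ℕ} {Ω : Type*} [MeasurableSpace Ω] (P : Measure Ω)
    [IsProbabilityMeasure P]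
    (C : (Fin d → ℝ) → ℝ) (hC : IsCopula C)
    (N : (Fin d → ℝ) → ℝ) (hN : IsDNorm N) (hCN : HasDNormExpansion C N)
    (X : ℕ → Ω → Fin d → ℝ) (hXm : ∀ j, Measurable (X j)) (hXi : iIndepFun X P)
    (hXC : ∀ j x, P.real {ω | X j ω ≤ x} = C x)
    (k : ℕ → ℕ) (hk : ∀ n, 2 ≤ n → 1 ≤ k n ∧ k n ≤ n - 1)
    (hk_top : Tendsto k atTop atTop)
    (hk_div : Tendsto (fun n => (k n : ℝ) / (n : ℝ)) atTop (𝓝 0)) :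
    (asymptoticCov N).PosSemidef ∧
      TendstoInDistribution (fun n => normalizedIntermediateOS X n (k n)) atTop
        (id : EuclideanSpace ℝ (Fin d) → EuclideanSpace ℝ (Fin d)) (fun _ => P)
        (multivariateGaussian 0 (asymptoticCov N)) := by
  refine ⟨posSemidef_asymptoticCov hC hN hCN, ?_⟩
  obtain ⟨μ, hμp, hμ, hCμ⟩ := hC
  have hlaw : ∀ j, P.map (X j) = μ := fun j => by
    have := Measure.isProbabilityMeasure_map (μ := P) (hXm j).aemeasurable
    refine measure_ext_of_pi_Iic fun u => ?_
    rw [Measure.map_apply (hXm j) measurableSet_Iic]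
    exact (measureReal_eq_measureReal_iff).1 ((hXC j u).trans (hCμ u))
  -- Slutsky: the limit law of the vector of counts passes to the order statistics, because the
  -- difference vanishes in probability in each coordinate.
  refine tendstoInDistribution_of_tendstoInMeasure_sub _ _
    (tendstoInDistribution_scaledSum_exceed hμ hCμ hN hCN hXm hXi hlaw hk_top hk_div) ?_
    fun n => (measurable_normalizedIntermediateOS hXm n (k n)).aemeasurable
  rw [tendstoInMeasure_iff_norm]
  intro ε hε
  set δ := ε / (Fintype.card (Fin d) + 1) with hδ
  have hδ0 : 0 < δ := by positivity
  have hsum := tendsto_finsetSum Finset.univ fun i _ =>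
    tendsto_measure_normalizedIntermediateOS_sub hμ hXm hXi hlaw hk hk_top hk_div i hδ0
  rw [Finset.sum_const_zero] at hsum
  refine tendsto_of_tendsto_of_tendsto_of_le_of_le tendsto_const_nhds hsum
    (fun _ => zero_le) fun n => ?_
  refine (measure_mono fun ω hω => ?_).trans (measure_biUnion_finset_le Finset.univ _)
  rw [Set.mem_ofPred_eq] at hω
  obtain ⟨i, hi⟩ := EuclideanSpace.exists_le_abs_of_le_norm hε hω
  exact Set.mem_biUnion (Finset.mem_univ i) (by simpa [hδ] using hi)
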